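/- **Theorem.** Let $k\ge 3$, let $F=GF(q)$, let $C\subseteq F^n$ be a linear $(n,k,q)$-MDS code, and let $\mathcal K$ be a dual $n$-arc in $\Pi=PG(k-1,q)$ giving rise to $C$ as a Bruen--Silverman (BRS) code. If $\mathcal K$ contains two distinct primitive members, then every (not necessarily linear) $(n+1,k,q)$-MDS code extending $C$ is LE. Here the following terms are used. * An $(n,k,q)$-*MDS code* is a set of $q^k$ words of length $n$ over an alphabet of size $q$, no two distinct words of which agree in $k$ or more coordinate positions; it is *linear* if the alphabet is $F$ and the code is a $k$-dimensional subspace of $F^n$. An $(n+1,k,q)$-MDS code $C'$ *extends* $C$ if deleting some fixed coordinate position from all words of $C'$ gives $C$. * Two codes of length $m$ over $F$ are *equivalent* if one is obtained from the other by a permutation of the coordinate positions and permutations of the alphabet applied separately in each coordinate position. A code over $F$ is *LE* if it is equivalent to a linear code (a linear subspace of $F^m$). * A *dual $n$-arc* in $PG(d,q)$ is a collection of $n\ge d+1$ hyperplanes, no $d+1$ of which are incident with a common point. Its *$d$-fold points* are the points incident with exactly $d$ of its members. * Let $\Pi=PG(k-1,q)$ be embedded as the hyperplane at infinity of $\Sigma=PG(k,q)$.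 The arc $\mathcal K$ *gives rise to* $C$ *as a BRS code* if, for some numbering $\Pi_1,\dots,\Pi_n$ of the members of $\mathcal K$ and, for each $i$, some bijective labelling by the elements of $F$ of the $q$ hyperplanes of $\Sigma$ other than $\Pi$ that contain $\Pi_i$, the code $C$ consists of the words $(\lambda_1(P),\dots,\lambda_n(P))$, $P\in\Sigma\setminus\Pi$, where $\lambda_i(P)$ is the label of the hyperplane containing $\Pi_i$ and $P$. * Let $\Lambda$ be a hyperplane of $PG(d,q)$, $d\ge 2$. A set $A$ of points of $\Lambda$ is *primitive* if every set $S$ of $q^{d-1}$ points of $PG(d,q)\setminus\Lambda$, such that for all distinct $P,Q\in S$ the line $PQ$ meets $\Lambda$ in a point of $A$, is contained in a hyperplane of $PG(d,q)$. A member $\Lambda$ of a dual arc $\mathcal K$ in $PG(d,q)$, $d\ge 2$, is *primitive* if the set of points of $\Lambda$ that are not $d$-fold points of $\mathcal K$ is primitive. -/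

import Mathlib

namespace MDSArc

/-! ### Codes -/

section Codes

variable {A : Type*}

/-- An `(n,k,q)`-MDS code over the alphabet `A` of size `q`: a set of `q ^ k` words of length `n`,
no two (distinct) words of which agree in as many as `k` coordinate positions. -/
def IsMDSCode (n k q : ℕ) (C : Set (Fin n → A)) : Prop :=
  Finite A ∧ Nat.card A = q ∧ C.ncard = q ^ k ∧
    ∀ u ∈ C, ∀ v ∈ C, u ≠ v → {i | u i = v i}.ncard < k

/-- A linear `(n,k,q)`-MDS code: an `(n,k,q)`-MDS code over the field `F` of order `q` which is a
`k`-dimensional linear subspace of `F ^ n`. -/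
def IsLinearMDSCode {F : Type*} [Field F] (n k q : ℕ) (C : Set (Fin n → F)) : Prop :=
  IsMDSCode n k q C ∧ ∃ L : Submodule F (Fin n → F), (L : Set (Fin n → F)) = C ∧
    Module.finrank F L = k

/-- `C'` is an `(m,k,q)`-MDS code extending `C`: `m > n` and deleting some fixed set of `m - n`
coordinate positions from every word of `C'` gives `C`. The map `f` lists the positions kept, in
increasing order. -/
def IsMDSExtension {n m : ℕ} (k q : ℕ) (C : Set (Fin n → A)) (C' : Set (Fin m → A)) : Prop :=
  IsMDSCode m k q C' ∧ n < m ∧ ∃ f : Fin n ↪o Fin m, (fun w : Fin m → A => w ∘ f) '' C' = C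

/-- Equivalence of codes: `C₂` is obtained from `C₁` by permuting the coordinate positions and
applying to each coordinate position a permutation of the alphabet. (A permutation of the rows of
the array of words does not change the set of words.) -/
def CodeEquivalent {n : ℕ} (C₁ C₂ : Set (Fin n → A)) : Prop :=
  ∃ (σ : Equiv.Perm (Fin n)) (τ : Fin n → Equiv.Perm A),
    (fun (w : Fin n → A) (i : Fin n) => τ i (w (σ i))) '' C₁ = C₂

/-- A code over `F` is LE if it is equivalent to a linear code over `F`. -/
def IsLE {F : Type*} [Field F] {n : ℕ} (C : Set (Fin n → F)) : Prop :=
  ∃ L : Submodule F (Fin n → F), CodeEquivalent (L : Set (Fin n → F)) C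

end Codes

/-! ### Projective geometry

The points of the projective space of a vector space `V` are the elements of `Projectivization F V`;
its subspaces are the submodules of `V`, and its hyperplanes are the coatoms among them. -/

section Geometry

variable {F : Type*} [Field F] {V : Type*} [AddCommGroup V] [Module F V]

/-- The point `P` is incident with the projective subspace `H`. -/
def Lies (P : Projectivization F V) (H : Submodule F V) : Prop := P.submodule ≤ H

variable (F V) in
/-- The projective dimension of the projective space of `V`. -/
noncomputable def projDim : ℕ := Module.finrank F V - 1

/-- The Rédei set of `S` with respect to `H`: the points of the form `PQ ∩ H`, with `P`, `Q`
distinct points of `S`. -/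
def redeiSet (H : Submodule F V) (S : Set (Projectivization F V)) : Set (Projectivization F V) :=
  {R | Lies R H ∧ ∃ P ∈ S, ∃ Q ∈ S, P ≠ Q ∧ Lies R (P.submodule ⊔ Q.submodule)}

/-- A set `A` of points of the hyperplane `H` of `PG(d,q)` is primitive if every set `S` of
`q ^ (d - 1)` points off `H` whose Rédei set with respect to `H` is contained in `A` is contained
in a hyperplane. -/
def IsPrimitiveSet (H : Submodule F V) (A : Set (Projectivization F V)) : Prop :=
  (∀ P ∈ A, Lies P H) ∧
    ∀ S : Set (Projectivization F V), (∀ P ∈ S, ¬ Lies P H) →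
      S.ncard = Nat.card F ^ (projDim F V - 1) → redeiSet H S ⊆ A →
      ∃ H' : Submodule F V, IsCoatom H' ∧ ∀ P ∈ S, Lies P H'

/-- A dual `n`-arc in `PG(d,q)`: a collection of `n ≥ d + 1` hyperplanes, no `d + 1` of which are
incident with a common point. -/
def IsDualArc (n : ℕ) (K : Set (Submodule F V)) : Prop :=
  K.Finite ∧ K.ncard = n ∧ projDim F V + 1 ≤ n ∧ (∀ H ∈ K, IsCoatom H) ∧
    ∀ T ⊆ K, T.ncard = projDim F V + 1 → ¬ ∃ P : Projectivization F V, ∀ H ∈ T, Lies P H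

/-- The `d`-fold points of a dual arc `K` in `PG(d,q)`: the points incident with precisely `d`
members of `K`. -/
def foldPoints (K : Set (Submodule F V)) : Set (Projectivization F V) :=
  {P | {H ∈ K | Lies P H}.ncard = projDim F V}

/-- The member `H` of the dual arc `K` is primitive if the set of those points of `H` that are not
`d`-fold points of `K` is a primitive set. -/
def IsPrimitiveMember (K : Set (Submodule F V)) (H : Submodule F V) : Prop :=
  H ∈ K ∧ IsPrimitiveSet H ({P | Lies P H} \ foldPoints K)

end Geometry

/-! ### Bruen-Silverman codes

The projective space of `W` is embedded as the hyperplane at infinity `t = 0` in the projective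
space of `W × F`, whose points are written `(w : t)`. -/

section BRS

variable {F : Type*} [Field F] {W : Type*} [AddCommGroup W] [Module F W]

variable (F W) in
/-- The hyperplane at infinity of the projective space of `W × F`. -/
def hyperplaneAtInfinity : Submodule F (W × F) := LinearMap.ker (LinearMap.snd F W F)

/-- The hyperplanes, other than the hyperplane at infinity, of the projective space of `W × F`
that contain the subspace `H` of the hyperplane at infinity. -/
abbrev Pencil (H : Submodule F W) : Type _ :=
  {H' : Submodule F (W × F) // IsCoatom H' ∧ H' ≠ hyperplaneAtInfinity F W ∧
    H.map (LinearMap.inl F W F) ≤ H'}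

/-- `C` is a Bruen-Silverman code arising from the collection `K` of hyperplanes of the projective
space of `W`: for some numbering `Π 0, …, Π (n - 1)` of the members of `K`, and some labellings by
the elements of `F` of the hyperplanes (other than the one at infinity) through each `Π i`, the
words of `C` are the words `(w 0, …, w (n - 1))` arising from the affine points `P`, where `w i` is
the label of the hyperplane through `Π i` and `P`. -/
def IsBRSCode {n : ℕ} (K : Set (Submodule F W)) (C : Set (Fin n → F)) : Prop :=
  ∃ (e : Fin n ≃ K) (label : ∀ i : Fin n, Pencil (e i : Submodule F W) ≃ F),
    C = {w | ∃ P : Projectivization F (W × F), ¬ Lies P (hyperplaneAtInfinity F W) ∧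
      ∀ i : Fin n, ∃ H : Pencil (e i : Submodule F W), Lies P H.1 ∧ w i = label i H}

end BRS

end MDSArc

/-!
Let `k = d + 1`. With functionals `φ i` on `F ^ k` defining the members of the dual arc, the words
of the code are the vectors `(φ i w)` for `w` in `F ^ k`, up to permutations of the alphabet
(`IsBRSCode.exists_dual`). A word of an extension has one further coordinate `g w`, and the MDS
condition says that `g` is injective, hence bijective, on every affine line whose direction is a
`d`-fold point (`IsMDSExtension.exists_last_coordinate`). The extension is LE as soon as `g` is a
linear functional followed by a permutation of `F` (`isLE_range_insertNth`).

Let `ker φ₁` and `ker φ₂` be two primitive members. A fibre of `g` meets each affine hyperplane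
`φ₁ = a` in `q ^ (d - 1)` points, whose pairwise differences are not `d`-fold points, so primitivity
puts these points in a flat of codimension one in `φ₁ = a`; likewise for `φ₂`. As `d ≥ 2`, there is
a `d`-fold point `v₀` on both members, and the fibre of `g` over `c` is the zero set of the
displacement `h` determined by `g (w + h w • v₀) = c`. This `h` is affine on all the hyperplanes
`φ₁ = a` and `φ₂ = b` (`displacement_affine_of_isPrimitiveSet`), so it is affine up to a
multiple of `φ₁ * φ₂`. Such a multiple would make the fibre a cylinder over a hyperbolic paraboloid,
whose chords in the hyperplanes `φ₁ = a` would take the direction of a `d`-fold point of `ker φ₁`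
outside `ker φ₂` for some `a`; so there is none (`exists_dual_of_affine_on_two_pencils`).
Hence the fibres of `g` are hyperplanes, and being disjoint they are parallel
(`exists_perm_comp_dual_of_displacement`).
-/

namespace MDSArc

open Module

variable {F : Type*} [Field F] {V : Type*} [AddCommGroup V] [Module F V]

/-! ### Hyperplanes as kernels of functionals -/

theorem lies_mk_iff (v : V) (hv : v ≠ 0) (H : Submodule F V) :
    Lies (Projectivization.mk F v hv) H ↔ v ∈ H := by
  simp [Lies, Projectivization.submodule_mk, Submodule.span_singleton_le_iff_mem]

theorem exists_dual_apply_eq_one {φ : Dual F V} (hφ : φ ≠ 0) : ∃ u, φ u = 1 := by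
  obtain ⟨u, hu⟩ := DFunLike.ne_iff.1 hφ
  exact ⟨(φ u)⁻¹ • u, by simpa using inv_mul_cancel₀ hu⟩

theorem apply_eq_mul_of_ker_le {φ ψ : Dual F V} (h : LinearMap.ker φ ≤ LinearMap.ker ψ)
    {u : V} (hu : φ u = 1) (w : V) : ψ w = φ w * ψ u := by
  have : w - φ w • u ∈ LinearMap.ker ψ := h (by simp [hu])
  simpa [sub_eq_zero] using this

theorem isCoatom_ker_dual {φ : Dual F V} (hφ : φ ≠ 0) : IsCoatom (LinearMap.ker φ) := by
  obtain ⟨u, hu⟩ := exists_dual_apply_eq_one hφ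
  exact LinearMap.isCoatom_ker_of_surjective fun c => ⟨c • u, by simp [hu]⟩

theorem _root_.IsCoatom.exists_ker_dual_eq {H : Submodule F V} (hH : IsCoatom H) :
    ∃ φ : Dual F V, φ ≠ 0 ∧ LinearMap.ker φ = H := by
  obtain ⟨φ, hφ, hle⟩ := Submodule.exists_le_ker_of_lt_top H hH.lt_top
  refine ⟨φ, hφ, (hH.le_iff_eq ?_).1 hle⟩
  exact (isCoatom_ker_dual hφ).ne_top

/-! ### Primitive sets in affine hyperplanes -/

/-- Let `d` be the projective dimension of `V`. The affine hyperplane `φ = a` is identified, by a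
translation, with the points of the projective space of `V` off the hyperplane `ker φ`. In this form a primitive set `A` of `ker φ` says that
`q ^ (d - 1)` vectors of the affine hyperplane whose differences represent points of `A`
satisfy one more linear equation. -/
theorem IsPrimitiveSet.exists_dual [Finite F] {φ : Dual F V} (hφ : φ ≠ 0)
    {A : Set (Projectivization F V)} (hA : IsPrimitiveSet (LinearMap.ker φ) A) {a : F} {S : Set V}
    (hS : ∀ w ∈ S, φ w = a) (hcard : S.ncard = Nat.card F ^ (projDim F V - 1))
    (hdir : ∀ w ∈ S, ∀ w' ∈ S, ∀ h : w - w' ≠ 0, Projectivization.mk F (w - w') h ∈ A) :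
    ∃ (ψ : Dual F V) (s : F), ¬ LinearMap.ker φ ≤ LinearMap.ker ψ ∧ ∀ w ∈ S, ψ w = s := by
  obtain ⟨u, hu⟩ := exists_dual_apply_eq_one hφ
  classical
  -- Translation by `p` moves `φ = a` to `φ = 1`, where a vector is determined by its point.
  set p : V := (1 - a) • u with hp
  have hone : ∀ w ∈ S, φ (w + p) = 1 := fun w hw => by simp [hp, hS w hw, hu]
  have hne : ∀ w ∈ S, w + p ≠ 0 := fun w hw h0 => by
    have := hone w hw
    simp [h0] at this
  -- The first branch is a filler, never taken on `S`.
  let m : V → Projectivization F V := fun w =>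
    if h : w + p = 0 then Projectivization.mk F u (by rintro rfl; simp at hu)
    else Projectivization.mk F (w + p) h
  have hm : ∀ w (hw : w ∈ S), m w = Projectivization.mk F (w + p) (hne w hw) :=
    fun w hw => dif_neg (hne w hw)
  have hinj : Set.InjOn m S := by
    intro w hw w' hw' h
    rw [hm w hw, hm w' hw', Projectivization.mk_eq_mk_iff'] at h
    obtain ⟨c, hc⟩ := h
    have h1 := congrArg φ hc
    rw [map_smul, hone w hw, hone w' hw', smul_eq_mul, mul_one] at h1
    rw [h1, one_smul] at hc
    exact (add_right_cancel hc).symm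
  obtain ⟨H, hH, hSH⟩ := hA.2 (m '' S)
    (by
      rintro _ ⟨w, hw, rfl⟩ h
      rw [hm w hw, lies_mk_iff, LinearMap.mem_ker, hone w hw] at h
      exact one_ne_zero h)
    (by rw [hinj.ncard_image, hcard])
    (by
      rintro R ⟨hR, _, ⟨w, hw, rfl⟩, _, ⟨w', hw', rfl⟩, -, hRl⟩
      induction R using Projectivization.ind with
      | h r hr =>
      rw [hm w hw, hm w' hw', lies_mk_iff, Projectivization.submodule_mk,
        Projectivization.submodule_mk, Submodule.mem_sup] at hRl
      obtain ⟨x, hx, y, hy, hxy⟩ := hRl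
      obtain ⟨α, rfl⟩ := Submodule.mem_span_singleton.1 hx
      obtain ⟨β, rfl⟩ := Submodule.mem_span_singleton.1 hy
      rw [lies_mk_iff, LinearMap.mem_ker, ← hxy, map_add, map_smul, map_smul, hone w hw,
        hone w' hw', smul_eq_mul, smul_eq_mul, mul_one, mul_one] at hR
      have hβ : β = -α := (neg_eq_of_add_eq_zero_right hR).symm
      have hr' : α • (w - w') = r := by rw [← hxy, hβ]; module
      have hww : w - w' ≠ 0 := by rintro h; rw [h, smul_zero] at hr'; exact hr hr'.symm
      have := hdir w hw w' hw' hww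
      rwa [(Projectivization.mk_eq_mk_iff' F r (w - w') hr hww).2 ⟨α, hr'⟩])
  obtain ⟨ψ, hψ, rfl⟩ := hH.exists_ker_dual_eq
  have hψS : ∀ w ∈ S, ψ w = -ψ p := fun w hw => by
    have := hSH _ ⟨w, hw, rfl⟩
    rw [hm w hw, lies_mk_iff, LinearMap.mem_ker, map_add] at this
    exact eq_neg_of_add_eq_zero_left this
  refine ⟨ψ, -ψ p, fun hle => ?_, hψS⟩
  have hSne : S.Nonempty := by
    apply Set.nonempty_of_ncard_ne_zero
    rw [hcard]
    exact pow_ne_zero _ Nat.card_pos.ne'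
  obtain ⟨w, hw⟩ := hSne
  have h1 := apply_eq_mul_of_ker_le hle hu (w + p)
  rw [hone w hw, one_mul, map_add, hψS w hw, neg_add_cancel] at h1
  refine hψ (LinearMap.ext fun x => ?_)
  rw [apply_eq_mul_of_ker_le hle hu x, ← h1, mul_zero, LinearMap.zero_apply]

/-! ### Functions that are affine on two pencils of hyperplanes -/

/-- A function that is affine on every hyperplane of two parallel classes `φ₁ = a` and `φ₂ = b` is
affine up to a multiple of `φ₁ * φ₂`. The multiple vanishes if some direction `v₁` of the
first class, not of the second, is one along which the function is nowhere constant: otherwise the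
slope along `v₁` on `φ₁ = a` would be a nonconstant affine function of `a`, hence zero somewhere. -/
theorem exists_dual_of_affine_on_two_pencils {φ₁ φ₂ : Dual F V} {e₁ e₂ v₁ : V}
    (h₁₁ : φ₁ e₁ = 1) (h₁₂ : φ₁ e₂ = 0) (h₂₁ : φ₂ e₁ = 0) (h₂₂ : φ₂ e₂ = 1)
    (hv₁ : φ₁ v₁ = 0) (hv₂ : φ₂ v₁ ≠ 0) {h : V → F}
    (H₁ : ∀ a, ∃ ψ : Dual F V, ψ v₁ ≠ 0 ∧ ∀ w u, φ₁ w = a → φ₁ u = 0 → h (w + u) = h w + ψ u)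
    (H₂ : ∀ b, ∃ ψ : Dual F V, ∀ w u, φ₂ w = b → φ₂ u = 0 → h (w + u) = h w + ψ u) :
    ∃ ψ : Dual F V, ∀ w, h w = ψ w + h 0 := by
  choose α hα0 hα using H₁
  choose β hβ using H₂
  have hcomm : ∀ a z, φ₁ z = 0 → φ₂ z = 0 → α a z = β 0 z := fun a z h1 h2 => by
    have h3 := hα a (a • e₁) z (by simp [h₁₁]) h1
    have h4 := hβ 0 (a • e₁) z (by simp [h₂₁]) h2
    exact add_left_cancel (h3.symm.trans h4)
  -- The slope along `e₂` on the hyperplane `φ₁ = x` is an affine function of `x`.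
  have hslope : ∀ x, α x e₂ = α 0 e₂ + x * (β 1 e₁ - β 0 e₁) := fun x => by
    have h1 := hα x (x • e₁) e₂ (by simp [h₁₁]) h₁₂
    have h2 := hβ 1 e₂ (x • e₁) h₂₂ (by simp [h₂₁])
    have h3 := hα 0 0 e₂ (by simp) h₁₂
    have h4 := hβ 0 0 (x • e₁) (by simp) (by simp [h₂₁])
    rw [zero_add] at h3 h4
    rw [add_comm, h2, h3, h4, map_smul, map_smul, smul_eq_mul, smul_eq_mul] at h1
    linear_combination -h1
  have hE : β 1 e₁ - β 0 e₁ = 0 := by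
    by_contra hE
    set z := v₁ - φ₂ v₁ • e₂ with hz
    have hz1 : φ₁ z = 0 := by simp [hz, hv₁, h₁₂]
    have hz2 : φ₂ z = 0 := by simp [hz, h₂₂]
    have hval : ∀ x, α x v₁ = φ₂ v₁ * (α 0 e₂ + x * (β 1 e₁ - β 0 e₁)) + β 0 z := fun x => by
      rw [← hcomm x z hz1 hz2, ← hslope x, hz, map_sub, map_smul, smul_eq_mul]; ring
    refine hα0 (-(φ₂ v₁ * α 0 e₂ + β 0 z) / (φ₂ v₁ * (β 1 e₁ - β 0 e₁))) ?_
    rw [hval]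
    field_simp
    ring
  refine ⟨α 0 ∘ₗ (LinearMap.id - φ₁.smulRight e₁) + β 0 e₁ • φ₁, fun w => ?_⟩
  set z := w - φ₁ w • e₁ - φ₂ w • e₂ with hz
  have hz1 : φ₁ z = 0 := by simp [hz, h₁₁, h₁₂]
  have hz2 : φ₂ z = 0 := by simp [hz, h₂₁, h₂₂]
  have h1 := hα (φ₁ w) (φ₁ w • e₁) (φ₂ w • e₂ + z) (by simp [h₁₁]) (by simp [h₁₂, hz1])
  have h2 := hβ 0 0 (φ₁ w • e₁) (by simp) (by simp [h₂₁])
  have hw : φ₁ w • e₁ + (φ₂ w • e₂ + z) = w := by rw [hz]; abel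
  have hw' : w - φ₁ w • e₁ = φ₂ w • e₂ + z := by rw [hz]; abel
  rw [zero_add] at h2
  rw [hw, h2, map_add, map_smul, map_smul, hslope, hE, hcomm _ z hz1 hz2] at h1
  rw [h1]
  simp only [LinearMap.add_apply, LinearMap.comp_apply, LinearMap.sub_apply, LinearMap.id_apply,
    LinearMap.smulRight_apply, LinearMap.smul_apply, hw', map_add, map_smul, smul_eq_mul,
    hcomm 0 z hz1 hz2]
  ring

/-! ### Functions that are injective on the lines in the fold directions -/

/-- A nonzero vector is a fold vector of a family of functionals on a space of dimension `d + 1` if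
precisely `d` members of the family vanish at it; for the functionals defining a dual arc this means
that the vector represents a `d`-fold point. -/
def IsFoldVector {ι : Type*} (φ : ι → Dual F V) (v : V) : Prop :=
  v ≠ 0 ∧ {i | φ i v = 0}.ncard + 1 = finrank F V

section

variable {ι : Type*} {φ : ι → Dual F V} {g : V → F}

theorem IsFoldVector.smul {v : V} (hv : IsFoldVector φ v) {c : F} (hc : c ≠ 0) :
    IsFoldVector φ (c • v) := by
  refine ⟨smul_ne_zero hc hv.1, ?_⟩
  rw [← hv.2]
  simp [hc]

/-- Any `d` hyperplanes of a dual arc in a space of projective dimension `d` meet in a point, and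
this point lies on no other hyperplane of the arc. -/
theorem exists_isFoldVector [FiniteDimensional F V] [Finite ι]
    (harc : ∀ v ≠ 0, {i | φ i v = 0}.ncard < finrank F V)
    {T : Set ι} (hT : T.ncard + 1 = finrank F V) :
    ∃ v, IsFoldVector φ v ∧ {i | φ i v = 0} = T := by
  have := Fintype.ofFinite T
  have hker : LinearMap.ker (LinearMap.pi fun i : T => φ i) ≠ ⊥ := by
    apply LinearMap.ker_ne_bot_of_finrank_lt
    rw [finrank_fintype_fun_eq_card, ← Nat.card_eq_fintype_card, Nat.card_coe_set_eq]
    omega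
  obtain ⟨v, hv, hv0⟩ := Submodule.exists_mem_ne_zero_of_ne_bot hker
  have hTv : T ⊆ {i | φ i v = 0} := fun i hi => congrFun (LinearMap.mem_ker.1 hv) ⟨i, hi⟩
  have heq : T = {i | φ i v = 0} :=
    Set.eq_of_subset_of_ncard_le hTv (by have := harc v hv0; omega) (Set.toFinite _)
  exact ⟨v, ⟨hv0, by rw [← heq, hT]⟩, heq.symm⟩

theorem bijective_on_fold_line [Finite F] (hg : ∀ w v, IsFoldVector φ v → g (w + v) ≠ g w) {v : V}
    (hv : IsFoldVector φ v) (w : V) : Function.Bijective fun t : F => g (w + t • v) := by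
  refine Finite.injective_iff_bijective.1 fun t t' h => ?_
  by_contra hne
  refine hg (w + t' • v) ((t - t') • v) (hv.smul (sub_ne_zero.2 hne)) ?_
  rw [← h]
  congr 1
  module

theorem ncard_affine_hyperplane [Finite F] [FiniteDimensional F V] {φ : Dual F V} (hφ : φ ≠ 0)
    (a : F) : {w | φ w = a}.ncard = Nat.card F ^ (finrank F V - 1) := by
  obtain ⟨u, hu⟩ := exists_dual_apply_eq_one hφ
  have himg : {w | φ w = a} = (fun w => w + a • u) '' (LinearMap.ker φ : Set V) := by
    ext w
    refine ⟨fun hw => ⟨w - a • u, ?_, by simp⟩, ?_⟩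
    · have hw' : φ w = a := hw
      simp [hu, hw']
    · rintro ⟨z, hz, rfl⟩
      have hz' : φ z = 0 := hz
      simp [hu, hz']
  rw [himg, Set.ncard_image_of_injective _ (add_left_injective _), ← Nat.card_coe_set_eq]
  have h1 : Nat.card (LinearMap.ker φ) = Nat.card F ^ finrank F (LinearMap.ker φ) :=
    Module.natCard_eq_pow_finrank
  have h2 : finrank F (LinearMap.ker φ) + 1 = finrank F V :=
    Dual.finrank_ker_add_one_of_ne_zero hφ
  rw [← h2, Nat.add_sub_cancel, ← h1]
  rfl

/-- Lines in a fold direction partition the affine hyperplane `φ₁ = a`, and each of them meets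
the fibre of `g` over `c` once. -/
theorem ncard_fiber_inter_affine_hyperplane [Finite F] [FiniteDimensional F V]
    (hg : ∀ w v, IsFoldVector φ v → g (w + v) ≠ g w) {φ₁ : Dual F V} (hφ₁ : φ₁ ≠ 0) {v : V}
    (hv : IsFoldVector φ v) (hv₁ : φ₁ v = 0) (hdim : 2 ≤ finrank F V) (a c : F) :
    {w | φ₁ w = a ∧ g w = c}.ncard = Nat.card F ^ (projDim F V - 1) := by
  have hinj : Set.InjOn (fun p : V × F => p.1 + p.2 • v)
      ({w | φ₁ w = a ∧ g w = c} ×ˢ (Set.univ : Set F)) := by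
    rintro ⟨w, t⟩ ⟨⟨-, hw⟩, -⟩ ⟨w', t'⟩ ⟨⟨-, hw'⟩, -⟩ h
    simp only at h hw hw'
    have h1 : w' = w + (t - t') • v := by
      rw [sub_smul, ← add_sub_assoc, h, add_sub_cancel_right]
    have h2 : t - t' = 0 := (bijective_on_fold_line hg hv w).1 (by simp [← h1, hw, hw'])
    rw [h2, zero_smul, add_zero] at h1
    rw [h1, sub_eq_zero.1 h2]
  have himg : (fun p : V × F => p.1 + p.2 • v) ''
      ({w | φ₁ w = a ∧ g w = c} ×ˢ (Set.univ : Set F)) = {w | φ₁ w = a} := by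
    ext w
    constructor
    · rintro ⟨⟨w', t⟩, ⟨⟨h, -⟩, -⟩, rfl⟩
      simp only at h
      simp [h, hv₁]
    · intro hw
      obtain ⟨t, ht⟩ := (bijective_on_fold_line hg hv w).2 c
      have hw' : φ₁ w = a := hw
      exact ⟨(w + t • v, -t), ⟨⟨by simp [hw', hv₁], ht⟩, trivial⟩, by simp⟩
  have h := hinj.ncard_image
  rw [himg, ncard_affine_hyperplane hφ₁, Set.ncard_prod, Set.ncard_univ] at h
  obtain ⟨m, hm⟩ := Nat.exists_eq_add_of_le hdim
  rw [projDim, hm]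
  rw [hm, show 2 + m - 1 = m + 1 by omega, pow_succ] at h
  rw [show 2 + m - 1 - 1 = m by omega]
  exact (Nat.eq_of_mul_eq_mul_right Nat.card_pos h).symm

/-- If `ker φ₁` is a primitive member, the fibres of `g` meet the hyperplanes `φ₁ = a` in flats that
are transversal to every fold direction of `ker φ₁`. -/
theorem exists_dual_of_isPrimitiveSet [Finite F] [FiniteDimensional F V]
    (hg : ∀ w v, IsFoldVector φ v → g (w + v) ≠ g w) {φ₁ : Dual F V} (hφ₁ : φ₁ ≠ 0)
    {A : Set (Projectivization F V)} (hA : IsPrimitiveSet (LinearMap.ker φ₁) A)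
    (hAφ : ∀ v (hv : v ≠ 0), φ₁ v = 0 → ¬ IsFoldVector φ v → Projectivization.mk F v hv ∈ A)
    {v₀ : V} (hv₀ : IsFoldVector φ v₀) (hv₀₁ : φ₁ v₀ = 0) (hdim : 2 ≤ finrank F V) (a c : F) :
    ∃ (ψ : Dual F V) (s : F), (∀ v, IsFoldVector φ v → φ₁ v = 0 → ψ v ≠ 0) ∧
      ∀ w, φ₁ w = a → g w = c → ψ w = s := by
  obtain ⟨ψ, s, hle, hψ⟩ := hA.exists_dual hφ₁ (a := a) (S := {w | φ₁ w = a ∧ g w = c})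
    (fun w hw => hw.1) (ncard_fiber_inter_affine_hyperplane hg hφ₁ hv₀ hv₀₁ hdim a c)
    (fun w hw w' hw' hne => hAφ _ hne (by rw [map_sub, hw.1, hw'.1, sub_self])
      fun hf => hg w' _ hf (by rw [add_sub_cancel, hw.2, hw'.2]))
  refine ⟨ψ, s, fun v hv hv₁ h0 => hle ?_, fun w h1 h2 => hψ w ⟨h1, h2⟩⟩
  -- If `ψ v = 0`, moving along `v` to the fibre shows that `ψ` is constant on `φ₁ = a`.
  have hconst : ∀ w, φ₁ w = a → ψ w = s := fun w hw => by
    obtain ⟨t, ht⟩ := (bijective_on_fold_line hg hv w).2 c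
    have := hψ (w + t • v) ⟨by simp [hw, hv₁], ht⟩
    simpa [h0] using this
  obtain ⟨u, hu⟩ := exists_dual_apply_eq_one hφ₁
  intro z hz
  have hz' : φ₁ z = 0 := hz
  have h1 := hconst (a • u) (by simp [hu])
  have h2 := hconst (a • u + z) (by simp [hu, hz'])
  rw [map_add, h1] at h2
  exact left_eq_add.1 h2.symm

/-- The fibre of `g` over `c` is the zero set of the function `h` measuring, along a fold direction
`v₀` of `ker φ₁`, the displacement into the fibre. If `ker φ₁` is a primitive member, then `h` is
affine on each hyperplane `φ₁ = a`. -/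
theorem displacement_affine_of_isPrimitiveSet [Finite F] [FiniteDimensional F V]
    (hg : ∀ w v, IsFoldVector φ v → g (w + v) ≠ g w) {φ₁ : Dual F V} (hφ₁ : φ₁ ≠ 0)
    {A : Set (Projectivization F V)} (hA : IsPrimitiveSet (LinearMap.ker φ₁) A)
    (hAφ : ∀ v (hv : v ≠ 0), φ₁ v = 0 → ¬ IsFoldVector φ v → Projectivization.mk F v hv ∈ A)
    {v₀ : V} (hv₀ : IsFoldVector φ v₀) (hv₀₁ : φ₁ v₀ = 0) (hdim : 2 ≤ finrank F V) {c : F}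
    {h : V → F} (hh : ∀ w, g (w + h w • v₀) = c) (a : F) :
    ∃ ψ : Dual F V, (∀ v, IsFoldVector φ v → φ₁ v = 0 → ψ v ≠ 0) ∧
      ∀ w u, φ₁ w = a → φ₁ u = 0 → h (w + u) = h w + ψ u := by
  obtain ⟨ψ, s, hne, hψ⟩ := exists_dual_of_isPrimitiveSet hg hφ₁ hA hAφ hv₀ hv₀₁ hdim a c
  have h0 := hne v₀ hv₀ hv₀₁
  refine ⟨-(ψ v₀)⁻¹ • ψ, fun v hv hv₁ => ?_, fun w u hw hu => ?_⟩
  · simpa [h0] using hne v hv hv₁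
  · have h1 := hψ (w + h w • v₀) (by simp [hw, hv₀₁]) (hh w)
    have h2 := hψ (w + u + h (w + u) • v₀) (by simp [hw, hu, hv₀₁]) (hh (w + u))
    rw [map_add, map_smul, smul_eq_mul] at h1 h2
    rw [map_add] at h2
    rw [LinearMap.smul_apply, smul_eq_mul]
    field_simp
    linear_combination h2 - h1

/-- If, for every `c`, the displacement along `v₀` into the fibre of `g` over `c` is an affine
function, then the fibres are parallel hyperplanes, and `g` is a linear functional up to a
permutation of its values. -/
theorem exists_perm_comp_dual_of_displacement [Finite F] {v₀ : V}
    (hbij : ∀ w, Function.Bijective fun t : F => g (w + t • v₀)) {h : F → V → F}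
    (hh : ∀ c w, g (w + h c w • v₀) = c) (hψ : ∀ c, ∃ ψ : Dual F V, ∀ w, h c w = ψ w + h c 0) :
    ∃ (ψ : Dual F V) (τ : Equiv.Perm F), ∀ w, g w = τ (ψ w) := by
  choose ψ hψ using hψ
  have hpar : ∀ c, ψ c = ψ 0 := fun c => by
    by_cases hc : c = 0
    · rw [hc]
    ext u
    by_contra hne
    -- Otherwise the two displacements agree at some multiple of `u`, and the fibres meet.
    have hd : ψ c u - ψ 0 u ≠ 0 := sub_ne_zero.2 hne
    set t := (h 0 0 - h c 0) / (ψ c u - ψ 0 u) with ht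
    have heq : h c (t • u) = h 0 (t • u) := by
      rw [hψ c, hψ 0, map_smul, map_smul, smul_eq_mul, smul_eq_mul]
      have := div_mul_cancel₀ (h 0 0 - h c 0) hd
      rw [← ht] at this
      linear_combination this
    have h1 := hh c (t • u)
    rw [heq, hh 0] at h1
    exact hc h1.symm
  have hs : Function.Injective fun c => h c 0 := fun c c' hcc => by
    rw [← hh c 0, ← hh c' 0]
    simp only at hcc
    rw [hcc]
  have hsb := Finite.injective_iff_bijective.1 hs
  refine ⟨-ψ 0, (Equiv.ofBijective _ hsb).symm, fun w => ?_⟩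
  rw [Equiv.eq_symm_apply, Equiv.ofBijective_apply]
  have h0 : h (g w) w = 0 := (hbij w).1 (by simp [hh])
  rw [hψ, hpar] at h0
  rw [LinearMap.neg_apply]
  linear_combination h0

/-- Two primitive members of a dual arc force `g` to be linear up to a permutation of its values. -/
theorem exists_perm_comp_dual [Finite F] [FiniteDimensional F V] [Finite ι]
    (harc : ∀ v ≠ 0, {i | φ i v = 0}.ncard < finrank F V) (hφ : ∀ i, φ i ≠ 0)
    (hdim : 3 ≤ finrank F V) (hcard : finrank F V ≤ Nat.card ι)
    (hg : ∀ w v, IsFoldVector φ v → g (w + v) ≠ g w) {i₁ i₂ : ι} (hi : i₁ ≠ i₂)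
    {A : ι → Set (Projectivization F V)}
    (hA₁ : IsPrimitiveSet (LinearMap.ker (φ i₁)) (A i₁))
    (hA₂ : IsPrimitiveSet (LinearMap.ker (φ i₂)) (A i₂))
    (hAφ : ∀ i v (hv : v ≠ 0), φ i v = 0 → ¬ IsFoldVector φ v →
      Projectivization.mk F v hv ∈ A i) :
    ∃ (ψ : Dual F V) (τ : Equiv.Perm F), ∀ w, g w = τ (ψ w) := by
  have hfold : ∀ T₀ T₁ : Set ι, T₀ ⊆ T₁ → T₀.ncard + 1 ≤ finrank F V →
      finrank F V ≤ T₁.ncard + 1 → ∃ v, IsFoldVector φ v ∧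
        (∀ i ∈ T₀, φ i v = 0) ∧ ∀ i ∉ T₁, φ i v ≠ 0 := by
    intro T₀ T₁ h01 h0 h1
    obtain ⟨T, hT0, hT1, hT⟩ := Set.exists_subsuperset_card_eq h01
      (n := finrank F V - 1) (by omega) (by omega)
    obtain ⟨v, hv, rfl⟩ := exists_isFoldVector harc (T := T) (by omega)
    exact ⟨v, hv, fun i hi => hT0 hi, fun i hi h => hi (hT1 h)⟩
  obtain ⟨v₀, hv₀, hv₀T, -⟩ := hfold {i₁, i₂} Set.univ (Set.subset_univ _)
    (by rw [Set.ncard_pair hi]; omega) (by rw [Set.ncard_univ]; omega)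
  have hcompl : ∀ i : ι, finrank F V ≤ ({i}ᶜ : Set ι).ncard + 1 := fun i => by
    have := Set.ncard_add_ncard_compl {i}
    rw [Set.ncard_singleton] at this
    omega
  obtain ⟨v₁, hv₁, hv₁1, hv₁2⟩ := hfold {i₁} {i₂}ᶜ (by simpa using hi.symm)
    (by rw [Set.ncard_singleton]; omega) (hcompl i₂)
  obtain ⟨v₂, hv₂, hv₂2, hv₂1⟩ := hfold {i₂} {i₁}ᶜ (by simpa using hi)
    (by rw [Set.ncard_singleton]; omega) (hcompl i₁)
  have hv₀1 : φ i₁ v₀ = 0 := hv₀T _ (by simp)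
  have hv₀2 : φ i₂ v₀ = 0 := hv₀T _ (by simp)
  replace hv₁1 : φ i₁ v₁ = 0 := hv₁1 _ rfl
  replace hv₁2 : φ i₂ v₁ ≠ 0 := hv₁2 _ (by simp)
  replace hv₂2 : φ i₂ v₂ = 0 := hv₂2 _ rfl
  replace hv₂1 : φ i₁ v₂ ≠ 0 := hv₂1 _ (by simp)
  have hbij := bijective_on_fold_line hg hv₀
  choose h hh using fun c w => (hbij w).2 c
  refine exists_perm_comp_dual_of_displacement hbij hh fun c => ?_
  refine exists_dual_of_affine_on_two_pencils (φ₁ := φ i₁) (φ₂ := φ i₂)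
    (e₁ := (φ i₁ v₂)⁻¹ • v₂) (e₂ := (φ i₂ v₁)⁻¹ • v₁) (v₁ := v₁) (by simp [hv₂1])
    (by simp [hv₁1]) (by simp [hv₂2]) (by simp [hv₁2]) hv₁1 hv₁2 (fun a => ?_) (fun b => ?_)
  · obtain ⟨ψ, hne, hψ⟩ := displacement_affine_of_isPrimitiveSet hg (hφ i₁) hA₁ (hAφ i₁) hv₀ hv₀1
      (by omega) (hh c) a
    exact ⟨ψ, hne v₁ hv₁ hv₁1, hψ⟩
  · obtain ⟨ψ, -, hψ⟩ := displacement_affine_of_isPrimitiveSet hg (hφ i₂) hA₂ (hAφ i₂) hv₀ hv₀2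
      (by omega) (hh c) b
    exact ⟨ψ, hψ⟩

end

/-! ### Bruen-Silverman codes in coordinates -/

/-- The functional `(w, t) ↦ φ w - c * t`. For `φ ≠ 0` its kernel is a hyperplane through `ker φ`
other than the hyperplane at infinity; its affine part is the hyperplane `φ w = c`. -/
def pencilDual (φ : Dual F V) (c : F) : Dual F (V × F) :=
  φ ∘ₗ LinearMap.fst F V F - c • LinearMap.snd F V F

@[simp]
theorem pencilDual_apply (φ : Dual F V) (c : F) (p : V × F) :
    pencilDual φ c p = φ p.1 - c * p.2 := rfl

theorem hyperplaneAtInfinity_eq_ker :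
    hyperplaneAtInfinity F V = LinearMap.ker (LinearMap.snd F V F : Dual F (V × F)) := rfl

theorem exists_ker_pencilDual_eq {φ : Dual F V} (H : Pencil (LinearMap.ker φ)) (hφ : φ ≠ 0) :
    ∃ c, LinearMap.ker (pencilDual φ c) = H.1 := by
  obtain ⟨H, hH, hinf, hle⟩ := H
  obtain ⟨Φ, hΦ, rfl⟩ := hH.exists_ker_dual_eq
  obtain ⟨u, hu⟩ := exists_dual_apply_eq_one hφ
  have hker : LinearMap.ker φ ≤ LinearMap.ker (Φ ∘ₗ LinearMap.inl F V F) := fun w hw =>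
    hle (Submodule.mem_map_of_mem hw)
  have hval : ∀ p : V × F, Φ p = φ p.1 * Φ (u, 0) + p.2 * Φ (0, 1) := fun p => by
    have h1 := apply_eq_mul_of_ker_le hker hu p.1
    simp only [LinearMap.comp_apply, LinearMap.inl_apply] at h1
    rw [← h1, ← smul_eq_mul, ← map_smul, ← map_add]
    simp
  have hm : Φ (u, 0) ≠ 0 := fun h0 => by
    refine hinf (((isCoatom_ker_dual ?_).le_iff_eq hH.ne_top).1 ?_)
    · intro h
      simpa using LinearMap.congr_fun h ((0 : V), (1 : F))
    · intro p hp
      have hp' : p.2 = 0 := hp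
      rw [LinearMap.mem_ker, hval, h0, hp']
      ring
  refine ⟨-Φ (0, 1) / Φ (u, 0), ?_⟩
  ext p
  rw [LinearMap.mem_ker, LinearMap.mem_ker, hval p, pencilDual_apply]
  have : φ p.1 * Φ (u, 0) + p.2 * Φ (0, 1)
      = Φ (u, 0) * (φ p.1 - -Φ (0, 1) / Φ (u, 0) * p.2) := by field_simp; ring
  rw [this, mul_eq_zero, or_iff_right hm]

/-- The hyperplanes of the pencil of `ker φ` are the hyperplanes `φ w = c * t`. -/
theorem exists_equiv_pencil {H : Submodule F V} {φ : Dual F V} (hφ : φ ≠ 0)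
    (hH : LinearMap.ker φ = H) :
    ∃ ε : F ≃ Pencil H, ∀ c, (ε c).1 = LinearMap.ker (pencilDual φ c) := by
  subst hH
  obtain ⟨u, hu⟩ := exists_dual_apply_eq_one hφ
  let p : F → Pencil (LinearMap.ker φ) := fun c => ⟨LinearMap.ker (pencilDual φ c), by
    refine isCoatom_ker_dual fun h => ?_
    simpa [hu] using LinearMap.congr_fun h (u, 0), by
    intro h
    have h1 : ((u, 0) : V × F) ∈ hyperplaneAtInfinity F V := by
      rw [hyperplaneAtInfinity_eq_ker]; simp
    rw [← h] at h1
    simp [hu] at h1, by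
    rintro _ ⟨w, hw, rfl⟩
    have hw' : φ w = 0 := hw
    simp [hw']⟩
  have hp : Function.Bijective p := by
    constructor
    · intro c c' h
      have h1 : LinearMap.ker (pencilDual φ c) = LinearMap.ker (pencilDual φ c') :=
        congrArg Subtype.val h
      have h2 : ((c • u, 1) : V × F) ∈ LinearMap.ker (pencilDual φ c) := by simp [hu]
      rw [h1] at h2
      simpa [hu, sub_eq_zero] using h2
    · intro H
      obtain ⟨c, hc⟩ := exists_ker_pencilDual_eq H hφ
      exact ⟨c, Subtype.ext hc⟩
  exact ⟨Equiv.ofBijective p hp, fun c => rfl⟩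

/-- In terms of functionals `φ i` defining the members of the arc, the words of a Bruen-Silverman
code are the vectors `(φ i w)`, up to a permutation of the alphabet in each coordinate position. -/
theorem IsBRSCode.exists_dual {n : ℕ} {K : Set (Submodule F V)} {C : Set (Fin n → F)}
    (hBRS : IsBRSCode K C) (hK : ∀ H ∈ K, IsCoatom H) :
    ∃ (e : Fin n ≃ K) (φ : Fin n → Dual F V) (l : Fin n → Equiv.Perm F),
      (∀ i, φ i ≠ 0) ∧ (∀ i, LinearMap.ker (φ i) = (e i : Submodule F V)) ∧
        C = Set.range fun w i => l i (φ i w) := by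
  obtain ⟨e, label, rfl⟩ := hBRS
  choose φ hφ hker using fun i => (hK _ (e i).2).exists_ker_dual_eq
  choose ε hε using fun i => exists_equiv_pencil (hφ i) (hker i)
  refine ⟨e, φ, fun i => (ε i).trans (label i), hφ, hker, ?_⟩
  ext x
  constructor
  · rintro ⟨P, hP, hx⟩
    induction P using Projectivization.ind with
    | h p hp =>
    rw [lies_mk_iff, hyperplaneAtInfinity_eq_ker, LinearMap.mem_ker, LinearMap.snd_apply] at hP
    refine ⟨p.2⁻¹ • p.1, funext fun i => ?_⟩
    obtain ⟨H, hH, hxH⟩ := hx i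
    obtain ⟨c, rfl⟩ := (ε i).surjective H
    rw [lies_mk_iff, hε, LinearMap.mem_ker, pencilDual_apply, sub_eq_zero] at hH
    rw [hxH]
    simp only [Equiv.trans_apply, map_smul, hH, smul_eq_mul]
    rw [mul_comm c, inv_mul_cancel_left₀ hP]
  · rintro ⟨w, rfl⟩
    have hne : ((w, 1) : V × F) ≠ 0 := fun h => one_ne_zero (congrArg Prod.snd h)
    refine ⟨Projectivization.mk F (w, 1) hne, ?_, fun i => ⟨ε i (φ i w), ?_, rfl⟩⟩
    · rw [lies_mk_iff, hyperplaneAtInfinity_eq_ker]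
      simp
    · rw [lies_mk_iff, hε]
      simp

section

variable {n : ℕ} {K : Set (Submodule F V)} {e : Fin n ≃ K} {φ : Fin n → Dual F V}

theorem ncard_members_through (hker : ∀ i, LinearMap.ker (φ i) = (e i : Submodule F V)) {v : V}
    (hv : v ≠ 0) : {H ∈ K | Lies (Projectivization.mk F v hv) H}.ncard = {i | φ i v = 0}.ncard := by
  have himg : {H ∈ K | Lies (Projectivization.mk F v hv) H} =
      (fun i => (e i : Submodule F V)) '' {i | φ i v = 0} := by
    ext H
    simp only [Set.mem_ofPred_eq, Set.mem_image, lies_mk_iff]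
    constructor
    · rintro ⟨hH, hvH⟩
      refine ⟨e.symm ⟨H, hH⟩, ?_, by simp⟩
      rw [← LinearMap.mem_ker, hker]
      simpa using hvH
    · rintro ⟨i, hi, rfl⟩
      exact ⟨(e i).2, by rw [← hker]; exact hi⟩
  rw [himg]
  exact Set.ncard_image_of_injective _ (Subtype.val_injective.comp e.injective)

theorem IsDualArc.ncard_zeros_lt {m : ℕ} (hK : IsDualArc m K)
    (hker : ∀ i, LinearMap.ker (φ i) = (e i : Submodule F V)) (hdim : 1 ≤ finrank F V)
    {v : V} (hv : v ≠ 0) : {i | φ i v = 0}.ncard < finrank F V := by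
  by_contra! hle
  rw [← ncard_members_through hker hv] at hle
  obtain ⟨T, hT, hcard⟩ := Set.exists_subset_card_eq hle
  exact hK.2.2.2.2 T (fun H hH => (hT hH).1) (by rw [hcard, projDim]; omega)
    ⟨Projectivization.mk F v hv, fun H hH => (hT hH).2⟩

theorem mk_mem_foldPoints_iff (hker : ∀ i, LinearMap.ker (φ i) = (e i : Submodule F V))
    (hdim : 1 ≤ finrank F V) {v : V} (hv : v ≠ 0) :
    Projectivization.mk F v hv ∈ foldPoints K ↔ IsFoldVector φ v := by
  rw [foldPoints, Set.mem_ofPred_eq, ncard_members_through hker hv, IsFoldVector, projDim]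
  constructor
  · intro h
    exact ⟨hv, by omega⟩
  · rintro ⟨-, h⟩
    omega

end

/-! ### Extensions by one coordinate -/

theorem exists_eq_succAbove {n : ℕ} (f : Fin n ↪o Fin (n + 1)) :
    ∃ j : Fin (n + 1), ∀ i, f i = j.succAbove i := by
  have hcard : (Set.range f)ᶜ.ncard = 1 := by
    have h := Set.ncard_add_ncard_compl (Set.range f)
    rw [← Set.image_univ, Set.ncard_image_of_injective _ f.injective, Set.ncard_univ,
      Nat.card_fin, Nat.card_fin, Set.image_univ] at h
    omega
  obtain ⟨j, hj⟩ := Set.ncard_eq_one.1 hcard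
  have h : f = Fin.succAboveOrderEmb j := by
    rw [← OrderEmbedding.range_inj]
    exact (compl_eq_comm.1 hj).symm.trans (Fin.range_succAbove j).symm
  exact ⟨j, fun i => by rw [h]; rfl⟩

/-- An extension of `C = {(l i (φ i w))}` adds one coordinate `g w`. Two words agreeing in it agree
in fewer than `k - 1` of the other positions, so that `g` takes different values at `w` and `w + v`
for every fold vector `v`. -/
theorem IsMDSExtension.exists_last_coordinate {n k q : ℕ} (hk : finrank F V = k)
    {φ : Fin n → Dual F V} {l : Fin n → Equiv.Perm F} (harc : ∀ v ≠ 0, {i | φ i v = 0}.ncard < finrank F V)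
    (hn : k ≤ n) {C' : Set (Fin (n + 1) → F)}
    (hC' : IsMDSExtension k q (Set.range fun w i => l i (φ i w)) C') :
    ∃ (j : Fin (n + 1)) (g : V → F), (∀ w v, IsFoldVector φ v → g (w + v) ≠ g w) ∧
      C' = Set.range fun w => j.insertNth (α := fun _ => F) (g w) fun i => l i (φ i w) := by
  subst hk
  obtain ⟨⟨-, -, -, hagree⟩, -, f, hf⟩ := hC'
  obtain ⟨j, hj⟩ := exists_eq_succAbove f
  have hword : ∀ w, ∃ x ∈ C', ∀ i, x (j.succAbove i) = l i (φ i w) := fun w => by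
    obtain ⟨x, hx, hxw⟩ : (fun i => l i (φ i w)) ∈ (fun w : Fin (n + 1) → F => w ∘ f) '' C' := by
      rw [hf]; exact ⟨w, rfl⟩
    exact ⟨x, hx, fun i => by rw [← hj]; exact congrFun hxw i⟩
  choose X hX hXw using hword
  have hXeq : ∀ w, X w = j.insertNth (α := fun _ => F) (X w j) fun i => l i (φ i w) := fun w => by
    rw [Fin.eq_insertNth_iff]
    exact ⟨rfl, funext fun i => hXw w i⟩
  refine ⟨j, fun w => X w j, fun w v hv heq => ?_, ?_⟩
  · have hsub : insert j (j.succAbove '' {i | φ i v = 0}) ⊆ {i | X (w + v) i = X w i} := by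
      rintro _ (rfl | ⟨i, hi, rfl⟩)
      · exact heq
      · have hi' : φ i v = 0 := hi
        simp only [Set.mem_ofPred_eq]
        rw [hXw, hXw, map_add, hi', add_zero]
    have hcard := Set.ncard_le_ncard hsub (Set.toFinite _)
    rw [Set.ncard_insert_of_notMem (by rintro ⟨i, -, hi⟩; exact Fin.succAbove_ne j i hi),
      Set.ncard_image_of_injective _ Fin.succAbove_right_injective, hv.2] at hcard
    refine absurd (hagree _ (hX (w + v)) _ (hX w) fun h => ?_) (not_lt.2 hcard)
    -- The words differ, since `v` is not a common zero of all the functionals.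
    have hall : {i | φ i v = 0} = Set.univ := Set.eq_univ_of_forall fun i => by
      have h1 := congrFun h (j.succAbove i)
      rw [hXw, hXw, (l i).apply_eq_iff_eq, map_add] at h1
      exact add_eq_left.1 h1
    have := harc v hv.1
    rw [hall, Set.ncard_univ, Nat.card_fin] at this
    omega
  · ext x
    constructor
    · intro hx
      obtain ⟨w, hw⟩ : x ∘ f ∈ Set.range fun w i => l i (φ i w) := by
        rw [← hf]; exact ⟨x, hx, rfl⟩
      refine ⟨w, ?_⟩
      change j.insertNth (α := fun _ => F) (X w j) (fun i => l i (φ i w)) = x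
      rw [← hXeq]
      by_contra hne
      refine absurd (hagree _ (hX w) _ hx hne) (not_lt.2 ?_)
      have hsub : Set.range j.succAbove ⊆ {i | X w i = x i} := by
        rintro _ ⟨i, rfl⟩
        have h1 := congrFun hw i
        simp only [Function.comp_apply, hj] at h1
        rw [Set.mem_ofPred_eq, hXw, h1]
      have hcard := Set.ncard_le_ncard hsub (Set.toFinite _)
      rw [← Set.image_univ, Set.ncard_image_of_injective _ Fin.succAbove_right_injective,
        Set.ncard_univ, Nat.card_fin] at hcard
      omega
    · rintro ⟨w, rfl⟩
      change j.insertNth (α := fun _ => F) (X w j) (fun i => l i (φ i w)) ∈ C'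
      rw [← hXeq]
      exact hX w

theorem isLE_range_insertNth {n : ℕ} (φ : Fin n → Dual F V) (l : Fin n → Equiv.Perm F)
    (ψ : Dual F V) (τ : Equiv.Perm F) (j : Fin (n + 1)) :
    IsLE (Set.range fun w => j.insertNth (α := fun _ => F) (τ (ψ w)) fun i => l i (φ i w)) := by
  let Φ : Fin (n + 1) → Dual F V := j.insertNth (α := fun _ => Dual F V) ψ φ
  refine ⟨LinearMap.range (LinearMap.pi Φ), 1,
    j.insertNth (α := fun _ => Equiv.Perm F) τ l, ?_⟩
  rw [LinearMap.coe_range, ← Set.range_comp]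
  congr 1
  funext w
  rw [Fin.eq_insertNth_iff]
  constructor
  · simp [Φ]
  · funext i
    simp [Φ, Fin.removeNth]

end MDSArc

theorem mainTheorem3 {F : Type*} [Field F] [Finite F] (q n k : ℕ) (hq : Nat.card F = q)
    (hk : 3 ≤ k)
    (C : Set (Fin n → F)) (hC : MDSArc.IsLinearMDSCode n k q C)
    (K : Set (Submodule F (Fin k → F))) (hK : MDSArc.IsDualArc n K)
    (hBRS : MDSArc.IsBRSCode K C)
    (hprim : ∃ H₁ H₂ : Submodule F (Fin k → F), H₁ ≠ H₂ ∧
      MDSArc.IsPrimitiveMember K H₁ ∧ MDSArc.IsPrimitiveMember K H₂)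
    (C' : Set (Fin (n + 1) → F)) (hC' : MDSArc.IsMDSExtension k q C C') :
    MDSArc.IsLE C' := by
  open MDSArc in
  have hdim : Module.finrank F (Fin k → F) = k := Module.finrank_fin_fun F
  obtain ⟨e, φ, l, hφ, hker, rfl⟩ := hBRS.exists_dual hK.2.2.2.1
  have harc : ∀ v ≠ 0, {i | φ i v = 0}.ncard < Module.finrank F (Fin k → F) :=
    fun v hv => hK.ncard_zeros_lt hker (by omega) hv
  have hn : k ≤ n := by
    have := hK.2.2.1
    rw [projDim, hdim] at this
    omega
  obtain ⟨j, g, hg, rfl⟩ := hC'.exists_last_coordinate hdim harc hn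
  obtain ⟨H₁, H₂, hne, ⟨hH₁, hP₁⟩, ⟨hH₂, hP₂⟩⟩ := hprim
  obtain ⟨i₁, hi₁⟩ := e.surjective ⟨H₁, hH₁⟩
  obtain ⟨i₂, hi₂⟩ := e.surjective ⟨H₂, hH₂⟩
  have hk₁ : LinearMap.ker (φ i₁) = H₁ := by rw [hker, hi₁]
  have hk₂ : LinearMap.ker (φ i₂) = H₂ := by rw [hker, hi₂]
  rw [← hk₁] at hP₁
  rw [← hk₂] at hP₂
  obtain ⟨ψ, τ, hgψ⟩ := exists_perm_comp_dual harc hφ (by omega)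
    (by rw [Nat.card_fin]; omega) hg (i₁ := i₁) (i₂ := i₂)
    (by rintro rfl; exact hne (hk₁.symm.trans hk₂))
    (A := fun i => {P | Lies P (LinearMap.ker (φ i))} \ foldPoints K) hP₁ hP₂
    (fun i v hv h0 hf => ⟨(lies_mk_iff v hv _).2 h0,
      fun h => hf ((mk_mem_foldPoints_iff hker (by omega) hv).1 h)⟩)
  simp only [hgψ]
  exact isLE_range_insertNth φ l ψ τ j
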